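/- Let $n\ge 1$. An algebraic variety in $\mathbb C^n$ is an irreducible (in particular nonempty) common zero set of a set of polynomials in $\mathbb C[z_1,\dots,z_n]$. For a compact set $X\subset\mathbb C^n$, let $\mathcal R(X)$ be the algebra of quotients $p/q$ of polynomials such that $q$ has no zero in $X$; a boundary of $X$ is a closed subset $\Delta\subseteq X$ such that every $f\in\mathcal R(X)$ attains its maximum modulus over $X$ at a point of $\Delta$, and the distinguished boundary $bX$ is the intersection of all boundaries of $X$ (the Shilov boundary of $\mathcal R(X)$). A distinguished variety in a bounded domain $G\subset\mathbb C^n$ is a nonempty set of the form $\Omega=G\cap W$, where $W\subset\mathbb C^n$ is an algebraic variety with $\dim W>0$ and \[ (W\cap\overline G)\cap\partial\overline G=(W\cap\overline G)\cap b\overline G . \] Let $\mathbb D^n=\{z\in\mathbb C^n:|z_i|<1,\ 1\le i\le n\}$ be the open unit polydisc, let $\pi_n:\mathbb C^n\to\mathbb C^n$ be the symmetrization map $\pi_n(z)=(s_1(z),\dots,s_n(z))$, where \[ s_k(z)=\sum_{1\le i_1<\dots<i_k\le n}z_{i_1}\cdots z_{i_k}, \] and let $\mathbb G_n=\pi_n(\mathbb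 D^n)$ be the symmetrized polydisc. Let $\Lambda\subset\mathbb G_n$. Then $\Lambda$ is a distinguished variety in $\mathbb G_n$ if and only if $\Lambda=\pi_n(\Omega)$ for some distinguished variety $\Omega$ in $\mathbb D^n$. -/

import Mathlib

/-- The zero set `Z(S) ⊆ ℂⁿ` of a set `S` of complex polynomials in `n` variables. -/
def zeroSet {n : ℕ} (S : Set (MvPolynomial (Fin n) ℂ)) : Set (Fin n → ℂ) :=
  {x | ∀ f ∈ S, MvPolynomial.eval x f = 0}

/-- Affine algebraic sets in `ℂⁿ`. -/
def IsAlgebraicSet {n : ℕ} (W : Set (Fin n → ℂ)) : Prop :=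
  ∃ S : Set (MvPolynomial (Fin n) ℂ), W = zeroSet S

/-- Affine algebraic varieties: irreducible algebraic sets, that is, nonempty algebraic sets that
are not the union of two proper algebraic subsets. -/
def IsAlgebraicVariety {n : ℕ} (W : Set (Fin n → ℂ)) : Prop :=
  IsAlgebraicSet W ∧ W.Nonempty ∧
    ∀ A B : Set (Fin n → ℂ), IsAlgebraicSet A → IsAlgebraicSet B → W = A ∪ B → W = A ∨ W = B

/-- The complex dimension of an algebraic set: the Krull dimension of its coordinate ring
`ℂ[z₁, …, zₙ] / I(W)`. -/
noncomputable def algebraicDim {n : ℕ} (W : Set (Fin n → ℂ)) : WithBot ℕ∞ :=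
  ringKrullDim
    (MvPolynomial (Fin n) ℂ ⧸ (MvPolynomial.vanishingIdeal ℂ W : Ideal (MvPolynomial (Fin n) ℂ)))

/-- `Δ` is a boundary of the compact set `X ⊆ ℂⁿ` for the algebra of all quotients `p / q` of
polynomials with `q` zero-free on `X`: a closed subset of `X` on which every function of the algebra
attains its maximum modulus over `X`. -/
def IsRationalBoundary {n : ℕ} (X Δ : Set (Fin n → ℂ)) : Prop :=
  Δ ⊆ X ∧ IsClosed Δ ∧
    ∀ p q : MvPolynomial (Fin n) ℂ, (∀ x ∈ X, MvPolynomial.eval x q ≠ 0) →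
      ∃ x ∈ Δ, ∀ y ∈ X,
        ‖MvPolynomial.eval y p / MvPolynomial.eval y q‖ ≤
          ‖MvPolynomial.eval x p / MvPolynomial.eval x q‖

/-- The distinguished (Shilov) boundary `bX` of a compact set `X ⊆ ℂⁿ`: the intersection of all
boundaries of `X` for the algebra of rational functions with no poles on `X`. -/
def distinguishedBoundary {n : ℕ} (X : Set (Fin n → ℂ)) : Set (Fin n → ℂ) :=
  ⋂₀ {Δ | IsRationalBoundary X Δ}

/-- `Ω` is a distinguished variety in the domain `G ⊆ ℂⁿ`: it is the nonempty intersection of `G`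
with an irreducible algebraic set `W` of positive dimension such that `W` meets the topological
boundary of `G` only in the distinguished boundary of the closure of `G`. -/
def IsDistinguishedVariety {n : ℕ} (G Ω : Set (Fin n → ℂ)) : Prop :=
  ∃ W : Set (Fin n → ℂ), IsAlgebraicVariety W ∧ 0 < algebraicDim W ∧
    Ω = G ∩ W ∧ Ω.Nonempty ∧
    (W ∩ closure G) ∩ frontier (closure G) = (W ∩ closure G) ∩ distinguishedBoundary (closure G)

/-- The open unit polydisc `𝔻ⁿ`. -/
def polydisc (n : ℕ) : Set (Fin n → ℂ) :=
  {z | ∀ i, ‖z i‖ < 1}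

/-- The symmetrization map `πₙ(z) = (s₁(z), …, sₙ(z))`, with `sₖ` the `k`-th elementary symmetric
polynomial; the coordinate with index `i : Fin n` is `s_{i+1}`. -/
noncomputable def symmetrization (n : ℕ) (z : Fin n → ℂ) : Fin n → ℂ :=
  fun i => MvPolynomial.eval z (MvPolynomial.esymm (Fin n) ℂ ((i : ℕ) + 1))

/-- The symmetrized polydisc `𝔾ₙ = πₙ(𝔻ⁿ)`. -/
noncomputable def symmetrizedPolydisc (n : ℕ) : Set (Fin n → ℂ) :=
  symmetrization n '' polydisc n

/- The map `πₙ` is a finite morphism `ℂⁿ → ℂⁿ`: composition with it embeds the polynomial ring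
into itself, with image the symmetric polynomials, and each `zᵢ` is a root of the monic polynomial
`∏ⱼ (T - zⱼ)` over that image. By lying over and incomparability, `πₙ` sends varieties to
varieties of the same dimension, and every variety is such an image. Cauchy's root bound makes
`πₙ` proper, and since its fibres are the orbits of the symmetric group it is also open, so that
preimages commute with closures and frontiers. It remains to compare distinguished boundaries.
That of the closed polydisc is the torus, by the maximum principle in each variable and explicit
peaking polynomials; that of its image is the image of the torus, because symmetrized high powers
of a peaking polynomial are symmetric and large only near one fibre of `πₙ`. -/

section Integral

variable {R S : Type*} [CommRing R] [CommRing S] {f : R →+* S}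

theorem exists_isPrime_comap_eq_of_isIntegral (hf : f.IsIntegral) (P : Ideal R) [P.IsPrime]
    (I : Ideal S) (hIP : I.comap f ≤ P) : ∃ Q ≥ I, Q.IsPrime ∧ Q.comap f = P := by
  algebraize [f]
  exact Ideal.exists_ideal_over_prime_of_isIntegral P I hIP

theorem strictMono_primeSpectrum_comap_of_isIntegral (hf : f.IsIntegral) :
    StrictMono (PrimeSpectrum.comap f) := by
  algebraize [f]
  exact fun P Q hPQ => Ideal.IsIntegral.comap_lt_comap (R := R) (I := P.asIdeal) hPQ

theorem ringKrullDim_le_of_isIntegral_of_injective (hf : f.IsIntegral)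
    (hinj : Function.Injective f) : ringKrullDim R ≤ ringKrullDim S := by
  refine iSup_le fun l => ?_
  obtain ⟨P, -, hP, hPl⟩ := exists_isPrime_comap_eq_of_isIntegral hf l.head.asIdeal ⊥
    (Ideal.comap_bot_le_of_injective f hinj)
  algebraize [f]
  have : P.LiesOver l.head.asIdeal := ⟨hPl.symm⟩
  obtain ⟨L, hL, -⟩ := Ideal.exists_ltSeries_of_hasGoingUp l P
  exact hL ▸ Order.LTSeries.length_le_krullDim L

theorem ringKrullDim_eq_of_isIntegral_of_injective (hf : f.IsIntegral)
    (hinj : Function.Injective f) : ringKrullDim R = ringKrullDim S :=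
  (ringKrullDim_le_of_isIntegral_of_injective hf hinj).antisymm <|
    Order.krullDim_le_of_strictMono _ (strictMono_primeSpectrum_comap_of_isIntegral hf)

theorem ringKrullDim_quotient_comap_eq_of_isIntegral (hf : f.IsIntegral) (I : Ideal S) :
    ringKrullDim (R ⧸ I.comap f) = ringKrullDim (S ⧸ I) :=
  ringKrullDim_eq_of_isIntegral_of_injective (f := Ideal.quotientMap I f le_rfl)
    hf.quotient Ideal.quotientMap_injective

end Integral

section PolynomialMap

open MvPolynomial

variable {σ τ K : Type*}

theorem eval_comap {R : Type*} [CommSemiring R] (φ : MvPolynomial σ R →ₐ[R] MvPolynomial τ R)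
    (z : τ → R) (p : MvPolynomial σ R) : eval (comap φ z) p = eval z (φ p) := by
  have h : aeval (comap φ z) = (aeval z).comp φ := by ext; simp
  exact DFunLike.congr_fun h p

theorem continuous_comap {R : Type*} [CommSemiring R] [TopologicalSpace R]
    [IsTopologicalSemiring R] (φ : MvPolynomial σ R →ₐ[R] MvPolynomial τ R) :
    Continuous (comap φ) :=
  continuous_pi fun i => MvPolynomial.continuous_eval (φ (X i))

section Field

variable [Field K] {φ : MvPolynomial σ K →ₐ[K] MvPolynomial τ K}

theorem vanishingIdeal_image_comap (φ : MvPolynomial σ K →ₐ[K] MvPolynomial τ K)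
    (W : Set (τ → K)) :
    vanishingIdeal K (comap φ '' W) = (vanishingIdeal K W).comap φ.toRingHom := by
  ext p
  simp [eval_comap]

theorem vanishingIdeal_singleton_injective :
    Function.Injective fun x : σ → K => vanishingIdeal K {x} := by
  intro x y (h : vanishingIdeal K {x} = vanishingIdeal K {y})
  ext i
  have hi : X i - C (x i) ∈ vanishingIdeal K {y} := h.le (by simp)
  simpa [sub_eq_zero, eq_comm] using hi

variable [IsAlgClosed K] [Finite σ] [Finite τ]

theorem image_comap_zeroLocus (hφ : φ.toRingHom.IsIntegral) (Q : Ideal (MvPolynomial τ K)) :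
    comap φ '' zeroLocus K Q = zeroLocus K (Q.comap φ.toRingHom) := by
  refine Set.Subset.antisymm ?_ fun y hy => ?_
  · rintro _ ⟨z, hz, rfl⟩ p hp
    exact (eval_comap φ z p).trans (hz _ hp)
  · have hle : Q.comap φ.toRingHom ≤ vanishingIdeal K {y} := fun p hp => by simpa using hy p hp
    obtain ⟨M, hQM, hM, hMy⟩ := exists_isPrime_comap_eq_of_isIntegral hφ _ Q hle
    have hmax : M.IsMaximal := Ideal.isMaximal_of_isIntegral_of_isMaximal_comap' _ hφ M <|
      isMaximal_iff_eq_vanishingIdeal_singleton.mpr ⟨y, hMy⟩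
    obtain ⟨z, rfl⟩ := isMaximal_iff_eq_vanishingIdeal_singleton.mp hmax
    rw [← vanishingIdeal_image_comap, Set.image_singleton] at hMy
    exact ⟨z, fun p hp => hQM hp z rfl, vanishingIdeal_singleton_injective hMy⟩

theorem surjective_comap (hφ : φ.toRingHom.IsIntegral) (hinj : Function.Injective φ) :
    Function.Surjective (comap φ) := by
  have himage := image_comap_zeroLocus hφ ⊥
  rw [Ideal.comap_bot_of_injective φ.toRingHom hinj, zeroLocus_bot, zeroLocus_bot] at himage
  exact Set.range_eq_univ.mp (Set.image_univ.symm.trans himage)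

end Field

section NormedField

variable [NormedField K] {φ : MvPolynomial σ K →ₐ[K] MvPolynomial τ K}

theorem continuous_cauchyBound_map_eval {g : Polynomial (MvPolynomial σ K)} (hg : g.Monic) :
    Continuous fun y : σ → K => (g.map (eval y)).cauchyBound := by
  simp only [Polynomial.cauchyBound, hg.natDegree_map, (hg.map _).leadingCoeff, nnnorm_one, div_one,
    Polynomial.coeff_map]
  exact (Continuous.finset_sup_apply fun i _ =>
    (MvPolynomial.continuous_eval (g.coeff i)).nnnorm).add continuous_const

theorem isProperMap_comap [ProperSpace K] [Finite σ] [Finite τ] (hφ : φ.toRingHom.IsIntegral) :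
    IsProperMap (comap φ) := by
  cases nonempty_fintype τ
  refine isProperMap_iff_isCompact_preimage.mpr ⟨continuous_comap φ, fun L hL => ?_⟩
  refine Metric.isCompact_of_isClosed_isBounded (hL.isClosed.preimage (continuous_comap φ)) ?_
  refine Bornology.forall_isBounded_image_eval_iff.mp fun j => ?_
  obtain ⟨g, hg, hgj⟩ := hφ (X j)
  obtain ⟨C, hC⟩ := (hL.image (continuous_cauchyBound_map_eval hg)).bddAbove
  refine isBounded_iff_forall_norm_le.mpr ⟨C, Set.forall_mem_image.mpr fun z hz => ?_⟩
  have hroot : (g.map (eval (comap φ z))).IsRoot (z j) := by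
    have hcomp : eval (comap φ z) = (eval z).comp φ.toRingHom := RingHom.ext (eval_comap φ z)
    have hz := congrArg (eval z) hgj
    rwa [Polynomial.hom_eval₂, ← hcomp, ← Polynomial.eval_map, eval_X, map_zero] at hz
  exact (hroot.norm_lt_cauchyBound (hg.map _).ne_zero).le.trans
    (hC (Set.mem_image_of_mem _ hz))

end NormedField

end PolynomialMap

section OpenMaps

theorem image_inter_eq_image_inter_iff {α β : Type*} {f : α → β} {W : Set α} {S T : Set β} :
    f '' W ∩ S = f '' W ∩ T ↔ W ∩ f ⁻¹' S = W ∩ f ⁻¹' T := by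
  simp only [Set.ext_iff, Set.mem_inter_iff, and_congr_right_iff, Set.forall_mem_image,
    Set.mem_preimage]

theorem image_inter_frontier_closure_eq_iff {X Y : Type*} [TopologicalSpace X] [TopologicalSpace Y]
    {f : X → Y} (hcont : Continuous f) (hopen : IsOpenMap f) {W : Set X} {G B : Set Y} :
    f '' W ∩ closure G ∩ frontier (closure G) = f '' W ∩ closure G ∩ B ↔
      W ∩ closure (f ⁻¹' G) ∩ frontier (closure (f ⁻¹' G)) = W ∩ closure (f ⁻¹' G) ∩ f ⁻¹' B := by
  simp only [Set.inter_assoc, image_inter_eq_image_inter_iff, Set.preimage_inter,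
    hopen.preimage_frontier_eq_frontier_preimage hcont,
    hopen.preimage_closure_eq_closure_preimage hcont]

theorem isOpenMap_of_isQuotientMap_of_fibers {X Y ι : Type*} [TopologicalSpace X]
    [TopologicalSpace Y] {f : X → Y} {g : ι → X → X} (hf : Topology.IsQuotientMap f)
    (hg : ∀ i, Continuous (g i)) (hfg : ∀ x y, f x = f y ↔ ∃ i, g i x = y) : IsOpenMap f := by
  intro U hU
  have hsat : f ⁻¹' (f '' U) = ⋃ i, g i ⁻¹' U := by
    ext x
    simp only [Set.mem_preimage, Set.mem_image, eq_comm (b := f x), hfg, Set.mem_iUnion]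
    aesop
  rw [← hf.isOpen_preimage, hsat]
  exact isOpen_iUnion fun i => hU.preimage (hg i)

end OpenMaps

section Varieties

open MvPolynomial

variable {m n : ℕ}

theorem isAlgebraicSet_zeroLocus (I : Ideal (MvPolynomial (Fin n) ℂ)) :
    IsAlgebraicSet (zeroLocus ℂ I) :=
  ⟨I, rfl⟩

theorem IsAlgebraicSet.zeroLocus_vanishingIdeal {W : Set (Fin n → ℂ)} (hW : IsAlgebraicSet W) :
    zeroLocus ℂ (vanishingIdeal ℂ W) = W := by
  obtain ⟨S, rfl⟩ := hW
  have hspan : zeroSet S = zeroLocus ℂ (Ideal.span S) := (zeroLocus_span S).symm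
  rw [hspan]
  exact zeroLocus_vanishingIdeal_galoisConnection.l_u_l_eq_l _

theorem IsAlgebraicSet.inter {A B : Set (Fin n → ℂ)} (hA : IsAlgebraicSet A)
    (hB : IsAlgebraicSet B) : IsAlgebraicSet (A ∩ B) := by
  obtain ⟨S, rfl⟩ := hA
  obtain ⟨T, rfl⟩ := hB
  exact ⟨S ∪ T, Set.ext fun x => by simp only [zeroSet, Set.mem_inter_iff, Set.mem_ofPred_eq,
    Set.mem_union, or_imp, forall_and]⟩

theorem IsAlgebraicVariety.subset_or_subset {W A B : Set (Fin n → ℂ)} (hW : IsAlgebraicVariety W)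
    (hA : IsAlgebraicSet A) (hB : IsAlgebraicSet B) (hAB : W ⊆ A ∪ B) : W ⊆ A ∨ W ⊆ B := by
  have hcover : W = W ∩ A ∪ W ∩ B := by rwa [← Set.inter_union_distrib_left, Set.left_eq_inter]
  exact (hW.2.2 _ _ (hW.1.inter hA) (hW.1.inter hB) hcover).imp
    Set.left_eq_inter.mp Set.left_eq_inter.mp

theorem IsAlgebraicVariety.isPrime_vanishingIdeal {W : Set (Fin n → ℂ)}
    (hW : IsAlgebraicVariety W) : (vanishingIdeal ℂ W).IsPrime := by
  refine ⟨(Ideal.ne_top_iff_one _).mpr fun h => ?_, fun {f g} hfg => ?_⟩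
  · obtain ⟨w, hw⟩ := hW.2.1
    simpa using h w hw
  · have hcover : W ⊆ zeroSet {f} ∪ zeroSet {g} := fun x hx => by
      simpa [zeroSet] using hfg x hx
    simpa [zeroSet, Set.subset_def] using hW.subset_or_subset ⟨{f}, rfl⟩ ⟨{g}, rfl⟩ hcover

theorem IsAlgebraicSet.isAlgebraicVariety {W : Set (Fin n → ℂ)} (hW : IsAlgebraicSet W)
    (hprime : (vanishingIdeal ℂ W).IsPrime) : IsAlgebraicVariety W := by
  have hle {A : Set (Fin n → ℂ)} (hA : IsAlgebraicSet A)
      (h : vanishingIdeal ℂ A ≤ vanishingIdeal ℂ W) : W ⊆ A := by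
    rw [← hW.zeroLocus_vanishingIdeal, ← hA.zeroLocus_vanishingIdeal]
    exact zeroLocus_anti_mono h
  refine ⟨hW, Set.nonempty_iff_ne_empty.mpr fun hempty => hprime.ne_top ?_, fun A B hA hB hAB => ?_⟩
  · rw [hempty, vanishingIdeal_empty]
  · have hinf : vanishingIdeal ℂ A ⊓ vanishingIdeal ℂ B ≤ vanishingIdeal ℂ W :=
      fun f hf x hx => (hAB.le hx).elim (hf.1 x) (hf.2 x)
    exact (hprime.inf_le.mp hinf).imp
      (fun h => (hle hA h).antisymm (hAB ▸ Set.subset_union_left))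
      (fun h => (hle hB h).antisymm (hAB ▸ Set.subset_union_right))

variable {φ : MvPolynomial (Fin m) ℂ →ₐ[ℂ] MvPolynomial (Fin n) ℂ}

theorem IsAlgebraicVariety.image_comap {W : Set (Fin n → ℂ)} (hW : IsAlgebraicVariety W)
    (hφ : φ.toRingHom.IsIntegral) : IsAlgebraicVariety (comap φ '' W) := by
  have := hW.isPrime_vanishingIdeal
  refine IsAlgebraicSet.isAlgebraicVariety ?_ ?_
  · rw [← hW.1.zeroLocus_vanishingIdeal, image_comap_zeroLocus hφ]
    exact isAlgebraicSet_zeroLocus _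
  · rw [vanishingIdeal_image_comap]
    exact Ideal.comap_isPrime _ _

theorem algebraicDim_image_comap (hφ : φ.toRingHom.IsIntegral) (W : Set (Fin n → ℂ)) :
    algebraicDim (comap φ '' W) = algebraicDim W := by
  rw [algebraicDim, vanishingIdeal_image_comap]
  exact ringKrullDim_quotient_comap_eq_of_isIntegral hφ _

theorem IsAlgebraicVariety.exists_image_comap_eq {V : Set (Fin m → ℂ)} (hV : IsAlgebraicVariety V)
    (hφ : φ.toRingHom.IsIntegral) (hinj : Function.Injective φ) :
    ∃ W, IsAlgebraicVariety W ∧ comap φ '' W = V := by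
  have := hV.isPrime_vanishingIdeal
  obtain ⟨Q, -, hQ, hQV⟩ := exists_isPrime_comap_eq_of_isIntegral hφ (vanishingIdeal ℂ V) ⊥
    (Ideal.comap_bot_le_of_injective φ.toRingHom hinj)
  refine ⟨zeroLocus ℂ Q, (isAlgebraicSet_zeroLocus Q).isAlgebraicVariety ?_, ?_⟩
  · rwa [IsPrime.vanishingIdeal_zeroLocus]
  · rw [image_comap_zeroLocus hφ, hQV, hV.1.zeroLocus_vanishingIdeal]

theorem isDistinguishedVariety_iff_exists_image_comap (hφ : φ.toRingHom.IsIntegral)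
    (hinj : Function.Injective φ) (hopen : IsOpenMap (comap φ)) {G Λ : Set (Fin m → ℂ)}
    (hb : comap φ ⁻¹' distinguishedBoundary (closure G) =
      distinguishedBoundary (closure (comap φ ⁻¹' G))) :
    IsDistinguishedVariety G Λ ↔
      ∃ Ω, IsDistinguishedVariety (comap φ ⁻¹' G) Ω ∧ Λ = comap φ '' Ω := by
  have hbdry_iff (W : Set (Fin n → ℂ)) :=
    image_inter_frontier_closure_eq_iff (continuous_comap φ) hopen (W := W) (G := G)
      (B := distinguishedBoundary (closure G))
  rw [hb] at hbdry_iff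
  constructor
  · rintro ⟨V, hV, hdim, rfl, hne, hbdry⟩
    obtain ⟨W, hW, rfl⟩ := hV.exists_image_comap_eq hφ hinj
    have himage : comap φ '' (comap φ ⁻¹' G ∩ W) = G ∩ comap φ '' W :=
      Set.image_preimage_inter _ _ _
    exact ⟨comap φ ⁻¹' G ∩ W, ⟨W, hW, algebraicDim_image_comap hφ W ▸ hdim, rfl,
      Set.image_nonempty.mp (himage ▸ hne), (hbdry_iff W).mp hbdry⟩, himage.symm⟩
  · rintro ⟨_, ⟨W, hW, hdim, rfl, hne, hbdry⟩, rfl⟩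
    exact ⟨comap φ '' W, hW.image_comap hφ, (algebraicDim_image_comap hφ W).symm ▸ hdim,
      Set.image_preimage_inter _ _ _, hne.image _, (hbdry_iff W).mpr hbdry⟩

end Varieties

section Symmetrization

open MvPolynomial

theorem exists_comp_perm_eq_of_map_univ_eq {ι α : Type*} [Fintype ι] {z w : ι → α}
    (h : Finset.univ.val.map z = Finset.univ.val.map w) : ∃ σ : Equiv.Perm ι, z ∘ σ = w := by
  classical
  have hcard (a : α) : Nonempty ({i // w i = a} ≃ {i // z i = a}) := by
    have hcount := congrArg (Multiset.count a) h
    rw [Multiset.count_map, Multiset.count_map] at hcount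
    simp only [eq_comm (a := a)] at hcount
    refine Fintype.card_eq.mp ?_
    rw [Fintype.card_subtype, Fintype.card_subtype]
    exact hcount.symm
  obtain ⟨e⟩ := Classical.nonempty_pi.mpr hcard
  exact ⟨Equiv.ofFiberEquiv e, funext (Equiv.ofFiberEquiv_map e)⟩

theorem multiset_eq_of_esymm_eq {R : Type*} [CommRing R] [IsDomain R] {s t : Multiset R}
    (hcard : s.card = t.card) (h : ∀ k ≤ s.card, s.esymm k = t.esymm k) : s = t := by
  rw [← Polynomial.roots_multiset_prod_X_sub_C s, ← Polynomial.roots_multiset_prod_X_sub_C t,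
    Multiset.prod_X_sub_X_eq_sum_esymm, Multiset.prod_X_sub_X_eq_sum_esymm, ← hcard]
  congr 1
  exact Finset.sum_congr rfl fun k hk => by rw [h k (Finset.mem_range_succ_iff.mp hk)]

theorem isSymmetric_coeff_prod_X_sub_C_X (ι R : Type*) [Fintype ι] [CommRing R] (k : ℕ) :
    ((∏ i : ι, (Polynomial.X - Polynomial.C (X i : MvPolynomial ι R))).coeff k).IsSymmetric := by
  intro σ
  have hmap := Equiv.prod_comp σ fun i => Polynomial.X - Polynomial.C (X i : MvPolynomial ι R)
  conv_rhs => rw [← hmap]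
  rw [← AlgHom.coe_toRingHom, ← Polynomial.coeff_map, Polynomial.map_prod]
  simp

variable {n : ℕ}

/-- The algebra homomorphism `q ↦ q ∘ πₙ`, that is, `q(z₁, …, zₙ) ↦ q(s₁, …, sₙ)`, through which
`symmetrization n` becomes a morphism of affine spaces. -/
noncomputable def symmetrizationHom (n : ℕ) :
    MvPolynomial (Fin n) ℂ →ₐ[ℂ] MvPolynomial (Fin n) ℂ :=
  (symmetricSubalgebra (Fin n) ℂ).val.comp (esymmAlgHom (Fin n) ℂ n)

theorem comap_symmetrizationHom (n : ℕ) : comap (symmetrizationHom n) = symmetrization n := by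
  ext z i
  simp [symmetrizationHom, symmetrization, esymmAlgHom_apply]

theorem eval_symmetrizationHom (z : Fin n → ℂ) (p : MvPolynomial (Fin n) ℂ) :
    eval z (symmetrizationHom n p) = eval (symmetrization n z) p := by
  rw [← comap_symmetrizationHom, eval_comap]

theorem symmetrizationHom_injective (n : ℕ) : Function.Injective (symmetrizationHom n) :=
  Subtype.val_injective.comp (esymmAlgHom_fin_injective ℂ le_rfl)

theorem exists_symmetrizationHom_eq {p : MvPolynomial (Fin n) ℂ} (hp : p.IsSymmetric) :
    ∃ q, symmetrizationHom n q = p := by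
  obtain ⟨q, hq⟩ := esymmAlgHom_fin_surjective ℂ le_rfl ⟨p, hp⟩
  exact ⟨q, congrArg Subtype.val hq⟩

theorem symmetrizationHom_isIntegral (n : ℕ) : (symmetrizationHom n).toRingHom.IsIntegral := by
  have hX (i : Fin n) : (symmetrizationHom n).toRingHom.IsIntegralElem (X i) := by
    have hlifts : ∏ j, (Polynomial.X - Polynomial.C (X j)) ∈
        Polynomial.lifts (symmetrizationHom n).toRingHom :=
      (Polynomial.lifts_iff_coeff_lifts _).mpr fun k =>
        exists_symmetrizationHom_eq (isSymmetric_coeff_prod_X_sub_C_X (Fin n) ℂ k)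
    obtain ⟨g, hg, -, hmonic⟩ := Polynomial.lifts_and_natDegree_eq_and_monic hlifts
      (Polynomial.monic_prod_X_sub_C _ _)
    refine ⟨g, hmonic, ?_⟩
    rw [← Polynomial.eval_map, hg, Polynomial.eval_prod]
    exact Finset.prod_eq_zero (Finset.mem_univ i) (by simp)
  intro p
  induction p using MvPolynomial.induction_on with
  | C r =>
    exact (symmetrizationHom n).commutes r ▸ RingHom.isIntegralElem_map _
  | add p q hp hq => exact hp.add _ hq
  | mul_X p i hp => exact hp.mul _ (hX i)

theorem symmetrization_comp_perm (z : Fin n → ℂ) (σ : Equiv.Perm (Fin n)) :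
    symmetrization n (z ∘ σ) = symmetrization n z := by
  funext i
  rw [symmetrization, symmetrization, ← eval_rename, esymm_isSymmetric]

theorem symmetrization_eq_iff {z w : Fin n → ℂ} :
    symmetrization n z = symmetrization n w ↔ ∃ σ : Equiv.Perm (Fin n), z ∘ σ = w := by
  refine ⟨fun h => exists_comp_perm_eq_of_map_univ_eq ?_, ?_⟩
  · refine multiset_eq_of_esymm_eq (by simp) fun k hk => ?_
    rw [← aeval_esymm_eq_multiset_esymm (Fin n) ℂ, ← aeval_esymm_eq_multiset_esymm (Fin n) ℂ]
    cases k with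
    | zero => simp
    | succ k => exact congrFun h ⟨k, by simpa using hk⟩
  · rintro ⟨σ, rfl⟩
    exact (symmetrization_comp_perm z σ).symm

theorem isProperMap_symmetrization (n : ℕ) : IsProperMap (symmetrization n) :=
  comap_symmetrizationHom n ▸ isProperMap_comap (symmetrizationHom_isIntegral n)

theorem symmetrization_surjective (n : ℕ) : Function.Surjective (symmetrization n) :=
  comap_symmetrizationHom n ▸
    surjective_comap (symmetrizationHom_isIntegral n) (symmetrizationHom_injective n)

theorem isOpenMap_symmetrization (n : ℕ) : IsOpenMap (symmetrization n) := by
  have hproper := isProperMap_symmetrization n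
  exact isOpenMap_of_isQuotientMap_of_fibers
    (hproper.isClosedMap.isQuotientMap hproper.continuous (symmetrization_surjective n))
    (fun σ : Equiv.Perm (Fin n) => continuous_pi fun i => continuous_apply (σ i))
    fun _ _ => symmetrization_eq_iff

end Symmetrization

section RationalBoundary

open MvPolynomial

theorem exists_mem_pi_frontier_norm_le {ι F : Type*} [Finite ι] {E : ι → Type*}
    [∀ i, NormedAddCommGroup (E i)] [∀ i, NormedSpace ℂ (E i)] [∀ i, FiniteDimensional ℂ (E i)]
    [∀ i, Nontrivial (E i)] [NormedAddCommGroup F] [NormedSpace ℂ F] {U : ∀ i, Set (E i)}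
    {f : (∀ i, E i) → F} (hU : ∀ i, Bornology.IsBounded (U i))
    (hf : DifferentiableOn ℂ f (Set.univ.pi fun i => closure (U i))) {z : ∀ i, E i}
    (hz : z ∈ Set.univ.pi fun i => closure (U i)) :
    ∃ w ∈ Set.univ.pi fun i => frontier (U i), ‖f z‖ ≤ ‖f w‖ := by
  classical
  cases nonempty_fintype ι
  suffices h : ∀ s : Finset ι, ∃ w ∈ Set.univ.pi fun i => closure (U i),
      (∀ i ∈ s, w i ∈ frontier (U i)) ∧ ‖f z‖ ≤ ‖f w‖ by
    obtain ⟨w, -, hw, hle⟩ := h Finset.univ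
    exact ⟨w, fun i _ => hw i (Finset.mem_univ i), hle⟩
  intro s
  induction s using Finset.induction_on with
  | empty => exact ⟨z, hz, by simp, le_rfl⟩
  | insert a s ha ih =>
    obtain ⟨w, hwcl, hws, hle⟩ := ih
    have hupdate {ζ : E a} (hζ : ζ ∈ closure (U a)) :
        Function.update w a ζ ∈ Set.univ.pi fun i => closure (U i) :=
      (Set.update_mem_pi_iff_of_mem hwcl).mpr fun _ => hζ
    have hdiff : DiffContOnCl ℂ (fun ζ => f (Function.update w a ζ)) (U a) :=
      (hf.comp (fun ζ _ => (hasFDerivAt_update w ζ).differentiableAt.differentiableWithinAt)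
        fun ζ hζ => hupdate hζ).diffContOnCl
    obtain ⟨ζ, hζ, hmax⟩ := Complex.exists_mem_frontier_isMaxOn_norm (hU a)
      (closure_nonempty_iff.mp ⟨w a, hwcl a trivial⟩) hdiff
    refine ⟨Function.update w a ζ, hupdate (frontier_subset_closure hζ), ?_, hle.trans ?_⟩
    · intro i hi
      rcases eq_or_ne i a with rfl | hia
      · simpa using hζ
      · simpa [hia] using hws i (Finset.mem_of_mem_insert_of_ne hi hia)
    · simpa using hmax (hwcl a trivial)

variable {m n : ℕ}

theorem differentiable_eval (p : MvPolynomial (Fin n) ℂ) :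
    Differentiable ℂ fun z : Fin n → ℂ => eval z p :=
  fun z => (AnalyticOnNhd.eval_mvPolynomial p z trivial).differentiableAt

theorem isRationalBoundary_pi_frontier {U : Fin n → Set ℂ} (hU : ∀ i, Bornology.IsBounded (U i))
    (hne : ∀ i, (U i).Nonempty) :
    IsRationalBoundary (Set.univ.pi fun i => closure (U i))
      (Set.univ.pi fun i => frontier (U i)) := by
  have hsub : (Set.univ.pi fun i => frontier (U i)) ⊆ Set.univ.pi fun i => closure (U i) :=
    Set.pi_mono fun i _ => frontier_subset_closure
  have hcompact : IsCompact (Set.univ.pi fun i => frontier (U i)) :=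
    isCompact_univ_pi fun i =>
      (hU i).isCompact_closure.of_isClosed_subset isClosed_frontier frontier_subset_closure
  refine ⟨hsub, hcompact.isClosed, fun p q hq => ?_⟩
  have hdiff : DifferentiableOn ℂ (fun z => eval z p * (eval z q)⁻¹)
      (Set.univ.pi fun i => closure (U i)) :=
    (differentiable_eval p).differentiableOn.fun_mul
      ((differentiable_eval q).differentiableOn.fun_inv hq)
  have hreach {z : Fin n → ℂ} (hz : z ∈ Set.univ.pi fun i => closure (U i)) :=
    exists_mem_pi_frontier_norm_le hU hdiff hz
  obtain ⟨w₀, hw₀, -⟩ := hreach fun i _ => (hne i).some_mem |> subset_closure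
  obtain ⟨x, hx, hmax⟩ := hcompact.exists_isMaxOn ⟨w₀, hw₀⟩ (hdiff.continuousOn.mono hsub).norm
  refine ⟨x, hx, fun y hy => ?_⟩
  obtain ⟨w, hw, hle⟩ := hreach hy
  exact hle.trans (hmax hw)

theorem IsRationalBoundary.image_comap {X Δ : Set (Fin n → ℂ)} (hΔ : IsRationalBoundary X Δ)
    (hX : IsCompact X) (φ : MvPolynomial (Fin m) ℂ →ₐ[ℂ] MvPolynomial (Fin n) ℂ) :
    IsRationalBoundary (comap φ '' X) (comap φ '' Δ) := by
  obtain ⟨hsub, hclosed, hmax⟩ := hΔ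
  refine ⟨Set.image_mono hsub,
    ((hX.of_isClosed_subset hclosed hsub).image (continuous_comap φ)).isClosed, fun p q hq => ?_⟩
  simp only [Set.forall_mem_image, Set.exists_mem_image, eval_comap] at hq ⊢
  exact hmax (φ p) (φ q) fun _ hx => hq hx

theorem mem_distinguishedBoundary_of_forall_norm_eval_lt_one {X : Set (Fin n → ℂ)} {x : Fin n → ℂ}
    (hx : x ∈ X) {f : MvPolynomial (Fin n) ℂ} (hfx : eval x f = 1)
    (hf : ∀ y ∈ X, y ≠ x → ‖eval y f‖ < 1) : x ∈ distinguishedBoundary X := by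
  rintro Δ ⟨hsub, -, hmax⟩
  obtain ⟨w, hw, hle⟩ := hmax f 1 (by simp)
  have hwx : w = x := by
    by_contra hne
    exact (hf w (hsub hw) hne).not_ge (by simpa [hfx] using hle x hx)
  exact hwx ▸ hw

end RationalBoundary

section PeakFunctions

open MvPolynomial Filter Topology

theorem eventually_forall_norm_sum_pow_lt {α ι 𝕜 : Type*} [TopologicalSpace α] [Fintype ι]
    [NormedField 𝕜] {K : Set α} (hK : IsCompact K) {g : ι → α → 𝕜}
    (hg : ∀ i, ContinuousOn (g i) K) (hlt : ∀ i, ∀ z ∈ K, ‖g i z‖ < 1) {ε : ℝ} (hε : 0 < ε) :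
    ∀ᶠ N : ℕ in atTop, ∀ z ∈ K, ‖∑ i, g i z ^ N‖ < ε := by
  have hunif : TendstoUniformlyOn (fun (N : ℕ) z => ∑ i, ‖g i z‖ ^ N) 0 atTop K := by
    refine Antitone.tendstoUniformlyOn_of_forall_tendsto hK
      (fun N => continuousOn_finsetSum _ fun i _ => (hg i).norm.pow N)
      (fun z hz N M hNM => Finset.sum_le_sum fun i _ =>
        pow_le_pow_of_le_one (norm_nonneg _) (hlt i z hz).le hNM)
      continuousOn_const fun z hz => ?_
    simpa using tendsto_finsetSum Finset.univ fun i _ =>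
      tendsto_pow_atTop_nhds_zero_of_lt_one (norm_nonneg _) (hlt i z hz)
  filter_upwards [Metric.tendstoUniformlyOn_iff.mp hunif ε hε] with N hN z hz
  calc ‖∑ i, g i z ^ N‖ ≤ ∑ i, ‖g i z‖ ^ N :=
        (norm_sum_le _ _).trans_eq (Finset.sum_congr rfl fun i _ => norm_pow _ _)
    _ ≤ dist 0 (∑ i, ‖g i z‖ ^ N) := by
        rw [dist_zero_left]
        exact le_abs_self _
    _ < ε := hN z hz

theorem eventually_lt_norm_sum_pow {ι 𝕜 : Type*} [Fintype ι] [RCLike 𝕜] {c : ι → 𝕜}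
    (hc : ∀ i, c i = 1 ∨ ‖c i‖ < 1) (hone : ∃ i, c i = 1) {r : ℝ} (hr : r < 1) :
    ∀ᶠ N : ℕ in atTop, r < ‖∑ i, c i ^ N‖ := by
  classical
  have hlim : Tendsto (fun N : ℕ => ∑ i, c i ^ N) atTop (𝓝 (∑ i, if c i = 1 then 1 else 0)) := by
    refine tendsto_finsetSum _ fun i _ => ?_
    rcases hc i with h | h
    · rw [if_pos h]
      exact tendsto_const_nhds.congr fun N => by rw [h, one_pow]
    · have hne : c i ≠ 1 := fun h1 => by simp [h1] at h
      simpa [hne] using tendsto_pow_atTop_nhds_zero_of_norm_lt_one h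
  refine hlim.norm.eventually_const_lt (hr.trans_le ?_)
  obtain ⟨i, hi⟩ := hone
  rw [Finset.sum_boole, RCLike.norm_natCast, Nat.one_le_cast]
  exact Finset.card_pos.mpr ⟨i, by simpa using hi⟩

variable {n : ℕ}

theorem isSymmetric_sum_rename {ι R : Type*} [Fintype ι] [DecidableEq ι] [CommSemiring R]
    (f : MvPolynomial ι R) : (∑ σ : Equiv.Perm ι, rename σ f).IsSymmetric := by
  intro τ
  simp only [map_sum, rename_rename]
  exact Equiv.sum_comp (Equiv.mulLeft τ) fun σ : Equiv.Perm ι => rename σ f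

/- Averaging `f` over the symmetric group need not give a polynomial peaking along the fibre, but
averaging `f ^ N` does so up to small errors when `N` is large. -/
theorem symmetrization_mem_distinguishedBoundary {X : Set (Fin n → ℂ)} (hX : IsCompact X)
    {x : Fin n → ℂ} (hx : symmetrization n x ∈ X) {f : MvPolynomial (Fin n) ℂ} (hfx : eval x f = 1)
    (hf : ∀ y, symmetrization n y ∈ X → y ≠ x → ‖eval y f‖ < 1) :
    symmetrization n x ∈ distinguishedBoundary X := by
  rintro Δ ⟨hsub, hclosed, hmax⟩
  by_contra hxΔ
  have hK : IsCompact (symmetrization n ⁻¹' Δ) :=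
    (isProperMap_symmetrization n).isCompact_preimage (hX.of_isClosed_subset hclosed hsub)
  have hlt (σ : Equiv.Perm (Fin n)) (z : Fin n → ℂ) (hz : z ∈ symmetrization n ⁻¹' Δ) :
      ‖eval (z ∘ σ) f‖ < 1 := by
    rw [Set.mem_preimage, ← symmetrization_comp_perm z σ] at hz
    exact hf _ (hsub hz) fun h => hxΔ (h ▸ hz)
  have horbit (σ : Equiv.Perm (Fin n)) : eval (x ∘ σ) f = 1 ∨ ‖eval (x ∘ σ) f‖ < 1 := by
    rcases eq_or_ne (x ∘ σ) x with h | h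
    · exact .inl ((congrArg (eval · f) h).trans hfx)
    · exact .inr (hf _ ((symmetrization_comp_perm x σ).symm ▸ hx) h)
  have hfixed : ∃ σ : Equiv.Perm (Fin n), eval (x ∘ σ) f = 1 := ⟨1, hfx⟩
  have hcont (σ : Equiv.Perm (Fin n)) : Continuous fun z : Fin n → ℂ => eval (z ∘ σ) f :=
    (continuous_eval f).comp (continuous_pi fun i => continuous_apply (σ i))
  obtain ⟨N, hN, hxN⟩ := ((eventually_forall_norm_sum_pow_lt hK (fun σ => (hcont σ).continuousOn)
    hlt one_half_pos).and (eventually_lt_norm_sum_pow horbit hfixed one_half_lt_one)).exists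
  obtain ⟨p, hp⟩ := exists_symmetrizationHom_eq (isSymmetric_sum_rename (f ^ N))
  have heval (z : Fin n → ℂ) :
      eval (symmetrization n z) p = ∑ σ : Equiv.Perm (Fin n), eval (z ∘ σ) f ^ N := by
    rw [← eval_symmetrizationHom, hp]
    simp only [map_sum, eval_rename, map_pow]
  obtain ⟨w, hw, hle⟩ := hmax p 1 (by simp)
  obtain ⟨z, rfl⟩ := symmetrization_surjective n w
  have hxz := hle _ hx
  simp only [map_one, div_one, heval] at hxz
  exact hxz.not_gt ((hN z hw).trans hxN)

end PeakFunctions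

section Polydisc

open MvPolynomial

variable {n : ℕ}

theorem polydisc_eq_pi (n : ℕ) : polydisc n = Set.univ.pi fun _ => Metric.ball 0 1 := by
  ext z
  simp [polydisc]

theorem closure_polydisc (n : ℕ) :
    closure (polydisc n) = Set.univ.pi fun _ => Metric.closedBall 0 1 := by
  rw [polydisc_eq_pi, closure_pi_set]
  simp_rw [closure_ball (0 : ℂ) one_ne_zero]

/-- The unit torus `𝕋ⁿ`, which is the distinguished boundary of the closed polydisc. -/
def unitTorus (n : ℕ) : Set (Fin n → ℂ) :=
  Set.univ.pi fun _ => Metric.sphere 0 1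

theorem unitTorus_subset_closure_polydisc (n : ℕ) : unitTorus n ⊆ closure (polydisc n) :=
  closure_polydisc n ▸ Set.pi_mono fun _ _ => Metric.sphere_subset_closedBall

theorem isRationalBoundary_unitTorus (n : ℕ) :
    IsRationalBoundary (closure (polydisc n)) (unitTorus n) := by
  have h := isRationalBoundary_pi_frontier (U := fun _ : Fin n => Metric.ball 0 1)
    (fun _ => Metric.isBounded_ball) fun _ => Metric.nonempty_ball.mpr one_pos
  simp only [closure_ball (0 : ℂ) one_ne_zero, frontier_ball (0 : ℂ) one_ne_zero] at h
  rwa [closure_polydisc]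

/-- The polynomial `∏ᵢ (tᵢ + zᵢ) / (2 tᵢ)`, whose modulus on the closed polydisc peaks exactly at
the point `t` of the torus. -/
noncomputable def torusPeakPolynomial (t : Fin n → ℂ) : MvPolynomial (Fin n) ℂ :=
  ∏ i, C (t i)⁻¹ * (C (1 / 2) * C (t i) + C (1 / 2) * X i)

theorem eval_torusPeakPolynomial (t z : Fin n → ℂ) :
    eval z (torusPeakPolynomial t) = ∏ i, (t i)⁻¹ * (1 / 2 * t i + 1 / 2 * z i) := by
  simp [torusPeakPolynomial]

theorem eval_torusPeakPolynomial_self {t : Fin n → ℂ} (ht : t ∈ unitTorus n) :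
    eval t (torusPeakPolynomial t) = 1 := by
  rw [eval_torusPeakPolynomial]
  refine Finset.prod_eq_one fun i _ => ?_
  have hti : t i ≠ 0 := Metric.ne_of_mem_sphere (ht i trivial) one_ne_zero
  rw [← add_mul, add_halves, one_mul, inv_mul_cancel₀ hti]

theorem norm_eval_torusPeakPolynomial_lt_one {t z : Fin n → ℂ} (ht : t ∈ unitTorus n)
    (hz : z ∈ closure (polydisc n)) (hzt : z ≠ t) : ‖eval z (torusPeakPolynomial t)‖ < 1 := by
  have hti (i : Fin n) : ‖t i‖ = 1 := mem_sphere_zero_iff_norm.mp (ht i trivial)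
  have hzi (i : Fin n) : ‖z i‖ ≤ 1 :=
    mem_closedBall_zero_iff.mp ((closure_polydisc n ▸ hz) i trivial)
  have hle (i : Fin n) : ‖(1 / 2 * t i + 1 / 2 * z i : ℂ)‖ ≤ 1 := by
    simpa using convex_closedBall (0 : ℂ) 1 (mem_closedBall_zero_iff.mpr (hti i).le)
      (mem_closedBall_zero_iff.mpr (hzi i)) (one_half_pos (α := ℝ)).le one_half_pos.le
      (add_halves 1)
  obtain ⟨j, hj⟩ := Function.ne_iff.mp hzt
  have hlt : ‖(1 / 2 * t j + 1 / 2 * z j : ℂ)‖ < 1 := by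
    simpa using norm_combo_lt_of_ne (hti j).le (hzi j) hj.symm (one_half_pos (α := ℝ))
      one_half_pos (add_halves 1)
  rw [eval_torusPeakPolynomial, norm_prod]
  simp only [norm_mul, norm_inv, hti, inv_one, one_mul]
  rw [← Finset.mul_prod_erase _ _ (Finset.mem_univ j)]
  exact mul_lt_one_of_nonneg_of_lt_one_left (norm_nonneg _) hlt
    (Finset.prod_le_one (fun i _ => norm_nonneg _) fun i _ => hle i)

theorem distinguishedBoundary_closure_polydisc (n : ℕ) :
    distinguishedBoundary (closure (polydisc n)) = unitTorus n :=
  (Set.sInter_subset_of_mem (isRationalBoundary_unitTorus n)).antisymm fun _ ht =>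
    mem_distinguishedBoundary_of_forall_norm_eval_lt_one (unitTorus_subset_closure_polydisc n ht)
      (eval_torusPeakPolynomial_self ht) fun _ => norm_eval_torusPeakPolynomial_lt_one ht

theorem preimage_image_symmetrization {S : Set (Fin n → ℂ)}
    (hS : ∀ z ∈ S, ∀ σ : Equiv.Perm (Fin n), z ∘ σ ∈ S) :
    symmetrization n ⁻¹' (symmetrization n '' S) = S := by
  refine Set.Subset.antisymm ?_ (Set.subset_preimage_image _ _)
  rintro w ⟨z, hz, hzw⟩
  obtain ⟨σ, rfl⟩ := symmetrization_eq_iff.mp hzw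
  exact hS z hz σ

theorem preimage_symmetrizedPolydisc (n : ℕ) :
    symmetrization n ⁻¹' symmetrizedPolydisc n = polydisc n :=
  preimage_image_symmetrization fun _ hz σ i => hz (σ i)

theorem preimage_closure_symmetrizedPolydisc (n : ℕ) :
    symmetrization n ⁻¹' closure (symmetrizedPolydisc n) = closure (polydisc n) := by
  rw [(isOpenMap_symmetrization n).preimage_closure_eq_closure_preimage
    (isProperMap_symmetrization n).continuous, preimage_symmetrizedPolydisc]

theorem closure_symmetrizedPolydisc (n : ℕ) :
    closure (symmetrizedPolydisc n) = symmetrization n '' closure (polydisc n) := by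
  rw [← preimage_closure_symmetrizedPolydisc,
    Set.image_preimage_eq _ (symmetrization_surjective n)]

theorem isCompact_closure_polydisc (n : ℕ) : IsCompact (closure (polydisc n)) :=
  closure_polydisc n ▸ isCompact_univ_pi fun _ => isCompact_closedBall 0 1

theorem distinguishedBoundary_closure_symmetrizedPolydisc (n : ℕ) :
    distinguishedBoundary (closure (symmetrizedPolydisc n)) = symmetrization n '' unitTorus n := by
  have hcompact := isCompact_closure_polydisc n
  apply Set.Subset.antisymm
  · refine Set.sInter_subset_of_mem ?_
    rw [closure_symmetrizedPolydisc, ← comap_symmetrizationHom]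
    exact (isRationalBoundary_unitTorus n).image_comap hcompact _
  · rintro _ ⟨t, ht, rfl⟩
    have hmem {z : Fin n → ℂ} :
        symmetrization n z ∈ closure (symmetrizedPolydisc n) ↔ z ∈ closure (polydisc n) :=
      Set.ext_iff.mp (preimage_closure_symmetrizedPolydisc n) z
    refine symmetrization_mem_distinguishedBoundary ?_
      (hmem.mpr (unitTorus_subset_closure_polydisc n ht)) (eval_torusPeakPolynomial_self ht)
      fun z hz => norm_eval_torusPeakPolynomial_lt_one ht (hmem.mp hz)
    exact closure_symmetrizedPolydisc n ▸ hcompact.image (isProperMap_symmetrization n).continuous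

theorem preimage_distinguishedBoundary_closure_symmetrizedPolydisc (n : ℕ) :
    symmetrization n ⁻¹' distinguishedBoundary (closure (symmetrizedPolydisc n)) =
      distinguishedBoundary (closure (polydisc n)) := by
  rw [distinguishedBoundary_closure_symmetrizedPolydisc, distinguishedBoundary_closure_polydisc]
  exact preimage_image_symmetrization fun _ ht σ i _ => ht (σ i) trivial

end Polydisc

theorem theorem3p9 (n : ℕ) (hn : 1 ≤ n) (Λ : Set (Fin n → ℂ)) (hΛ : Λ ⊆ symmetrizedPolydisc n) :
    IsDistinguishedVariety (symmetrizedPolydisc n) Λ ↔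
      ∃ Ω : Set (Fin n → ℂ),
        IsDistinguishedVariety (polydisc n) Ω ∧ Λ = symmetrization n '' Ω := by
  have htransfer := isDistinguishedVariety_iff_exists_image_comap (symmetrizationHom_isIntegral n)
    (symmetrizationHom_injective n) (G := symmetrizedPolydisc n) (Λ := Λ)
  rw [comap_symmetrizationHom, preimage_symmetrizedPolydisc] at htransfer
  exact htransfer (isOpenMap_symmetrization n)
    (preimage_distinguishedBoundary_closure_symmetrizedPolydisc n)
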